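/- For $x,y\in\{0,1\}^n$ write $x\prec y$ if $x\neq y$ and $x_i\le y_i$ for all $i$. A function $f:\{0,1\}^n\to\{0,1\}$ is $k$-monotone if there are no $x_1\prec x_2\prec\dots\prec x_{k+1}$ in $\{0,1\}^n$ with $f(x_1)=1$ and $f(x_i)\ne f(x_{i+1})$ for all $1\le i\le k$. It is $\varepsilon$-far from $k$-monotone if $|\{x: f(x)\ne g(x)\}|\ge \varepsilon 2^n$ for every $k$-monotone $g:\{0,1\}^n\to\{0,1\}$. A non-adaptive, one-sided $q$-query $\varepsilon$-tester for $k$-monotonicity is a randomized algorithm with query access to $f:\{0,1\}^n\to\{0,1\}$ that makes at most $q$ queries, chosen depending only on its internal randomness (and not on the answers), accepts every $k$-monotone $f$ with probability $1$, and rejects every $f$ that is $\varepsilon$-far from $k$-monotone with probability at least $2/3$. There are absolute constants $\varepsilon_0\in(0,1]$ and $c>0$ such that the following holds. Let $k=k(n)$ be a sequence of integers with $k(n)\ge 2$ for all large $n$ and $k(n)=o(\sqrt n)$. Then for all sufficiently large $n$ and every $0<\varepsilon\le\varepsilon_0$, every non-adaptive, one-sided $q$-query $\varepsilon$-tester for $k(n)$-monotonicity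 of functions $\{0,1\}^n\to\{0,1\}$ satisfies $$q\;\ge\; c\,\exp\!\left(\frac{\sqrt n}{k(n)+1}\right).$$ In particular, with the same $\varepsilon_0$, testing $2$-monotonicity requires $2^{\Omega(\sqrt n)}$ queries: there is a constant $c'>0$ such that for all sufficiently large $n$ and every $0<\varepsilon\le\varepsilon_0$, every non-adaptive, one-sided $q$-query $\varepsilon$-tester for $2$-monotonicity of functions $\{0,1\}^n\to\{0,1\}$ satisfies $q\ge 2^{c'\sqrt n}$. -/

import Mathlib

open MeasureTheory Filter Asymptotics

universe u

/-- The Boolean cube `{0,1}^n` with its coordinatewise partial order (`false < true`). -/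
abbrev Cube (n : ℕ) : Type := Fin n → Bool

/-- A violation of `k`-monotonicity of `f`: a strictly increasing sequence of `k + 1` points,
starting at a point of value `1`, on which the values of `f` alternate. -/
def IsViolation {n : ℕ} (k : ℕ) (f : Cube n → Bool) (x : Fin (k + 1) → Cube n) : Prop :=
  StrictMono x ∧ f (x 0) = true ∧ ∀ i : Fin k, f (x i.castSucc) ≠ f (x i.succ)

/-- The property (set of functions) `M_k` of `k`-monotonicity. -/
def kMonotone (n k : ℕ) : Set (Cube n → Bool) :=
  {f | ¬ ∃ x : Fin (k + 1) → Cube n, IsViolation k f x}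

/-- The normalized Hamming distance between two Boolean functions. -/
noncomputable def cubeDist {n : ℕ} (f g : Cube n → Bool) : ℝ :=
  ((Finset.univ.filter fun x : Cube n => f x ≠ g x).card : ℝ) / 2 ^ n

/-- The distance of `f` to a (nonempty) property: the least distance to a member of it. -/
noncomputable def distToProperty {n : ℕ} (f : Cube n → Bool) (P : Set (Cube n → Bool)) : ℝ :=
  sInf (cubeDist f '' P)

/-- For a nonempty property the infimum is a minimum. -/
theorem distToProperty_isLeast {n : ℕ} (f : Cube n → Bool) {P : Set (Cube n → Bool)}
    (hP : P.Nonempty) : IsLeast (cubeDist f '' P) (distToProperty f P) :=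
  have hfin : (cubeDist f '' P).Finite := (Set.toFinite P).image _
  ⟨(hP.image _).csInf_mem hfin, fun _ hx => csInf_le hfin.bddBelow hx⟩

/-- The constant function `0` is `k`-monotone, so `M_k` is never empty. -/
theorem kMonotone_nonempty (n k : ℕ) : (kMonotone n k).Nonempty :=
  ⟨fun _ => false, fun ⟨_, _, h, _⟩ => Bool.false_ne_true h⟩

/-- A non-adaptive randomized query algorithm for functions `{0,1}^n → {0,1}`, with internal
randomness `ω ∈ Ω`: the list of query points depends on `ω` only, and the final verdict
(`true` = accept, `false` = reject) depends on `ω` and on the list of answers to these queries. -/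
structure NonAdaptiveAlgorithm (n : ℕ) (Ω : Type*) [MeasurableSpace Ω] where
  /-- the points that are queried -/
  queries : Ω → List (Cube n)
  /-- the verdict, given the answers to the queries -/
  verdict : Ω → List Bool → Bool
  /-- for every input function, acceptance is an event -/
  measurableSet_accept : ∀ f : Cube n → Bool,
    MeasurableSet {ω | verdict ω ((queries ω).map f) = true}

namespace NonAdaptiveAlgorithm

variable {n : ℕ} {Ω : Type*} [MeasurableSpace Ω]

/-- The output of the algorithm on the function `f`, with internal randomness `ω`. -/
def output (T : NonAdaptiveAlgorithm n Ω) (f : Cube n → Bool) (ω : Ω) : Bool :=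
  T.verdict ω ((T.queries ω).map f)

/-- The algorithm never makes more than `q` queries. -/
def QueriesAtMost (T : NonAdaptiveAlgorithm n Ω) (q : ℕ) : Prop :=
  ∀ ω, (T.queries ω).length ≤ q

/-- `T`, with randomness drawn from `μ`, is a tester with one-sided error for the property `P`
with proximity parameter `ε`. -/
def IsOneSidedTester (T : NonAdaptiveAlgorithm n Ω) (μ : Measure Ω)
    (P : Set (Cube n → Bool)) (ε : ℝ) : Prop :=
  (∀ f ∈ P, μ {ω | T.output f ω = true} = 1) ∧
  (∀ f, ε ≤ distToProperty f P → 2 / 3 ≤ μ {ω | T.output f ω = false})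

end NonAdaptiveAlgorithm

/-- Every non-adaptive tester with one-sided error for the property `P` with proximity parameter
`ε`, over any probability space, that makes at most `q` queries in the worst case,
has `q ≥ b`. -/
def NonAdaptiveOneSidedTestingRequires {n : ℕ} (P : Set (Cube n → Bool)) (ε b : ℝ) : Prop :=
  ∀ (Ω : Type u) [MeasurableSpace Ω] (μ : Measure Ω) [IsProbabilityMeasure μ]
    (T : NonAdaptiveAlgorithm n Ω) (q : ℕ),
    T.IsOneSidedTester μ P ε → T.QueriesAtMost q → b ≤ (q : ℝ)

/-! For almost every outcome of the randomness, a one-sided tester can reject `f` only if its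
queries contain an alternating chain of `k + 1` points; otherwise the answers extend to a
`k`-monotone function (`exists_kMonotone_extension`). So it suffices to find far functions of which
a small query set catches only a few.

These are `bandParity r s A` with `r = ⌊√n⌋`, `s` about `36 r / k`, and `A` containing at least half
of the coordinates. They alternate only in a band of width `r` for the weight off `A`, where
successive changes cost about `s` in weight on `A`. Hence an alternating chain contains two queries
differing in at least `12 r` coordinates, at most `r` of them off `A`
(`exists_raised_of_hasAltChain`). For a fixed pair a random `A` allows this with probability at most
`((3/4)^12 * 2)^r ≤ exp (-2 r)`. A union bound over `q ^ 2` pairs gives `q` of order at least `exp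
(√n / 2)`, for every `k` in range.

Farness is `exists_le_distToProperty_bandParity`. The band has constant measure, and over each of
its points the function is a block parity of the weight on `A`. Along every maximal chain of such a
fibre a `k`-monotone function errs at least `k s` times within `O(√n)` central levels
(`le_card_filter_ne_even_div`). Averaging over maximal chains, as in the LYM inequality, turns this
into a constant fraction of the fibre. -/

/-! ### Alternating chains and extension of partial functions -/

/-- There is an alternating chain of `j` points of `Q` (values `1, 0, 1, …` of `f`) below `x`. -/
def HasAltChain {n : ℕ} (f : Cube n → Bool) (Q : List (Cube n)) : ℕ → Cube n → Prop
  | 0, _ => True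
  | j + 1, x => ∃ y ∈ Q, y ≤ x ∧ f y = decide (Even j) ∧ HasAltChain f Q j y

namespace HasAltChain

variable {n : ℕ} {f : Cube n → Bool} {Q : List (Cube n)}

theorem mono_right {j : ℕ} {x y : Cube n} (h : HasAltChain f Q j x) (hxy : x ≤ y) :
    HasAltChain f Q j y := by
  cases j with
  | zero => trivial
  | succ j => obtain ⟨z, hz, hzx, h⟩ := h; exact ⟨z, hz, hzx.trans hxy, h⟩

theorem exists_chain {j : ℕ} {x : Cube n} (h : HasAltChain f Q (j + 1) x) :
    ∃ c : ℕ → Cube n, (∀ i ≤ j, c i ∈ Q ∧ f (c i) = decide (Even i)) ∧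
      (∀ i < j, c i ≤ c (i + 1)) ∧ c j ≤ x := by
  induction j generalizing x with
  | zero =>
    obtain ⟨y, hy, hyx, hfy, -⟩ := h
    refine ⟨fun _ => y, fun i hi => ?_, by simp, hyx⟩
    obtain rfl : i = 0 := by omega
    exact ⟨hy, hfy⟩
  | succ j ih =>
    obtain ⟨y, hy, hyx, hfy, h⟩ := h
    obtain ⟨c, hc, hlt, hle⟩ := ih h
    refine ⟨fun i => if i ≤ j then c i else y, fun i hi => ?_, fun i hi => ?_, by simpa using hyx⟩
    · by_cases hij : i ≤ j
      · simpa [hij] using hc i hij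
      · obtain rfl : i = j + 1 := by omega
        simpa using ⟨hy, hfy⟩
    · by_cases hij : i + 1 ≤ j
      · simpa [hij, show i ≤ j by omega] using hlt i hij
      · obtain rfl : i = j := by omega
        simpa using hle

end HasAltChain

/-- A partial function on the cube without an alternating chain of `k + 1` points extends to a
`k`-monotone function. -/
theorem exists_kMonotone_extension {n k : ℕ} (f : Cube n → Bool) (Q : List (Cube n))
    (hQ : ∀ x, ¬ HasAltChain f Q (k + 1) x) :
    ∃ g ∈ kMonotone n k, ∀ x ∈ Q, g x = f x := by
  classical
  -- The extension is the parity of `ℓ`, the longest chain length. As `ℓ` is monotone, a violation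
  -- would start at an odd value and increase `k` times, exceeding the bound `k`.
  set ℓ : Cube n → ℕ := fun x => Nat.findGreatest (fun j => HasAltChain f Q j x) k with hℓ
  have hspec : ∀ x, HasAltChain f Q (ℓ x) x := fun x =>
    Nat.findGreatest_spec (P := fun j => HasAltChain f Q j x) (Nat.zero_le k) trivial
  have hle : ∀ x, ℓ x ≤ k := fun x => Nat.findGreatest_le k
  have hmax : ∀ x, ¬ HasAltChain f Q (ℓ x + 1) x := by
    intro x h
    rcases (hle x).lt_or_eq with hlt | heq
    · have := Nat.le_findGreatest (P := fun j => HasAltChain f Q j x) hlt h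
      simp only [hℓ] at this
      omega
    · rw [heq] at h
      exact hQ x h
  have hmono : Monotone ℓ := fun x y hxy =>
    Nat.le_findGreatest (P := fun j => HasAltChain f Q j y) (hle x) ((hspec x).mono_right hxy)
  refine ⟨fun x => decide (Odd (ℓ x)), ?_, fun x hx => ?_⟩
  · rintro ⟨x, hx, h0, halt⟩
    have key : ∀ i (hi : i < k + 1), i + 1 ≤ ℓ (x ⟨i, hi⟩) := by
      intro i
      induction i with
      | zero =>
        intro hi
        have h1 : Odd (ℓ (x 0)) := by simpa using h0
        exact h1.pos
      | succ i ih =>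
        intro hi
        have h1 := ih (by omega)
        have h2 := halt ⟨i, by omega⟩
        have h3 : ℓ (x ⟨i, by omega⟩) ≤ ℓ (x ⟨i + 1, hi⟩) :=
          hmono (hx.monotone (by simp))
        have h4 : ℓ (x ⟨i, by omega⟩) ≠ ℓ (x ⟨i + 1, hi⟩) := by
          intro h
          apply h2
          simp only [Fin.castSucc_mk, Fin.succ_mk, h]
        omega
    have := key k (by omega)
    have := hle (x ⟨k, by omega⟩)
    omega
  -- A wrong value at `x ∈ Q` is exactly what allows `x` itself to prolong a longest chain below it.
  · by_contra hne
    apply hmax x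
    refine ⟨x, hx, le_rfl, ?_, hspec x⟩
    have h1 : decide (Odd (ℓ x)) ≠ f x := hne
    rcases Nat.even_or_odd (ℓ x) with h | h
    · have h2 : ¬ Odd (ℓ x) := Nat.not_odd_iff_even.2 h
      simpa [h, h2] using h1
    · have h2 : ¬ Even (ℓ x) := Nat.not_even_iff_odd.2 h
      simpa [h, h2] using h1

/-! ### Counting subsets -/

/-- Subsets that miss at most `r` elements of a set of at least `a` elements are rare. -/
theorem card_filter_sdiff_le {n a r : ℕ} (D : Finset (Fin n)) (hD : a ≤ D.card) :
    ((Finset.univ.filter fun A : Finset (Fin n) => (D \ A).card ≤ r).card : ℝ) ≤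
      2 ^ n * ((3 / 4) ^ a * 2 ^ r) := by
  classical
  -- For uniform `A`, `(1/2) ^ |D \ A|` is a product of independent factors of mean `3/4`, one per
  -- element of `D`; Markov's inequality then gives the bound.
  have h1 : ∑ A : Finset (Fin n), (1 / 2 : ℝ) ^ (D \ A).card = 2 ^ n * (3 / 4) ^ D.card := by
    have h := Finset.prod_add (fun _ : Fin n => (1 : ℝ)) (fun i => if i ∈ D then 1 / 2 else 1)
      Finset.univ
    have e1 : ∏ i : Fin n, ((1 : ℝ) + if i ∈ D then 1 / 2 else 1)
        = 2 ^ n * (3 / 4) ^ D.card := by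
      have : ∀ i : Fin n, ((1 : ℝ) + if i ∈ D then 1 / 2 else 1)
          = 2 * if i ∈ D then 3 / 4 else 1 := by
        intro i; split_ifs <;> norm_num
      simp_rw [this, Finset.prod_mul_distrib, Finset.prod_ite_mem]
      simp [div_pow]
    rw [← e1, h, Finset.powerset_univ]
    refine Finset.sum_congr rfl fun A _ => ?_
    rw [Finset.prod_const_one, one_mul, Finset.prod_ite_mem, Finset.prod_const]
    congr 2
    ext i
    simp [and_comm]
  have h2 : ((Finset.univ.filter fun A : Finset (Fin n) => (D \ A).card ≤ r).card : ℝ)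
      * (1 / 2) ^ r ≤ ∑ A : Finset (Fin n), (1 / 2 : ℝ) ^ (D \ A).card := by
    rw [← nsmul_eq_mul]
    refine (Finset.card_nsmul_le_sum _ _ _ fun A hA => ?_).trans
      (Finset.sum_le_univ_sum_of_nonneg fun A => by positivity)
    exact pow_le_pow_of_le_one (by norm_num) (by norm_num) (Finset.mem_filter.1 hA).2
  have h3 : (3 / 4 : ℝ) ^ D.card ≤ (3 / 4) ^ a :=
    pow_le_pow_of_le_one (by norm_num) (by norm_num) hD
  rw [h1] at h2
  have h4 : (1 / 2 : ℝ) ^ r * 2 ^ r = 1 := by rw [← mul_pow]; norm_num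
  calc _ = (((Finset.univ.filter fun A : Finset (Fin n) => (D \ A).card ≤ r).card : ℝ)
      * (1 / 2) ^ r) * 2 ^ r := by rw [mul_assoc, h4, mul_one]
    _ ≤ (2 ^ n * (3 / 4) ^ a) * 2 ^ r := by
      exact mul_le_mul_of_nonneg_right (h2.trans (by gcongr)) (by positivity)
    _ = _ := by ring

/-- At least half of all subsets have at least half of all elements. -/
theorem two_pow_le_two_mul_card_filter (n : ℕ) :
    2 ^ n ≤ 2 * (Finset.univ.filter fun A : Finset (Fin n) => n ≤ 2 * A.card).card := by
  classical
  have h1 : (Finset.univ.filter fun A : Finset (Fin n) => ¬ n ≤ 2 * A.card).card ≤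
      (Finset.univ.filter fun A : Finset (Fin n) => n ≤ 2 * A.card).card := by
    refine Finset.card_le_card_of_injOn (fun A => Aᶜ) (fun A hA => ?_) (compl_injective.injOn)
    simp only [Finset.coe_filter, Finset.mem_univ, true_and, Set.mem_ofPred_eq,
      Finset.card_compl, Fintype.card_fin] at hA ⊢
    omega
  have h2 := Finset.card_filter_add_card_filter_not (s := Finset.univ)
    (fun A : Finset (Fin n) => n ≤ 2 * A.card)
  simp only [Finset.card_univ, Fintype.card_finset, Fintype.card_fin] at h2
  omega

/-! ### The hard functions and their alternating chains -/

/-- The Hamming weight of `x` on the coordinates in `A`. -/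
def weightOn {n : ℕ} (A : Finset (Fin n)) (x : Cube n) : ℕ := (A.filter fun i => x i = true).card

/-- The coordinates where `y` is `1` and `x` is `0`. -/
def raised {n : ℕ} (x y : Cube n) : Finset (Fin n) :=
  Finset.univ.filter fun i => x i = false ∧ y i = true

/-- The hard functions: in the band where the weight outside `A` exceeds its central value by at
most `r`, they alternate with the weight on `A`, in steps of length `s`. -/
def bandParity {n : ℕ} (r s : ℕ) (A : Finset (Fin n)) (x : Cube n) : Bool :=
  decide ((Aᶜ.card / 2 ≤ weightOn Aᶜ x ∧ weightOn Aᶜ x ≤ Aᶜ.card / 2 + r) ∧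
    Even (weightOn A x / s))

theorem weightOn_add_card_raised {n : ℕ} (A : Finset (Fin n)) {x y : Cube n} (h : x ≤ y) :
    weightOn A x + (raised x y ∩ A).card = weightOn A y := by
  classical
  unfold weightOn raised
  rw [← Finset.card_union_of_disjoint]
  · congr 1
    ext i
    have := Bool.le_iff_imp.1 (h i)
    simp only [Finset.mem_union, Finset.mem_filter, Finset.mem_inter, Finset.mem_univ, true_and]
    cases hx : x i <;> cases hy : y i <;> simp_all
  · rw [Finset.disjoint_left]
    intro i hi hi'
    simp_all

theorem weightOn_mono {n : ℕ} (A : Finset (Fin n)) : Monotone (weightOn A) := fun x y h => by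
  rw [← weightOn_add_card_raised A h]
  exact Nat.le_add_right _ _

/-- The ends of an alternating chain of `bandParity r s A` differ a lot, but little outside `A`. -/
theorem exists_raised_of_hasAltChain {n k r s : ℕ} {A : Finset (Fin n)} {Q : List (Cube n)}
    {z : Cube n} (hs : 0 < s) (hk : 2 ≤ k) (hks : 36 * r ≤ k * s)
    (h : HasAltChain (bandParity r s A) Q (k + 1) z) :
    ∃ x ∈ Q, ∃ y ∈ Q, 12 * r ≤ (raised x y).card ∧ (raised x y \ A).card ≤ r := by
  classical
  obtain ⟨c, hc, hle, -⟩ := h.exists_chain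
  -- An even `l` gives both ends the value `1`, which places them, and so everything between them,
  -- in the band. The bound `k ≤ 3 * (l - 1)` is tight at `k = 3`.
  obtain ⟨l, hlk, hl, hkl⟩ : ∃ l, l ≤ k ∧ Even l ∧ k ≤ 3 * (l - 1) ∧ 2 ≤ l :=
    ⟨2 * (k / 2), by omega, even_two_mul _, by omega, by omega⟩
  have hmono : ∀ i j, i ≤ j → j ≤ l → c i ≤ c j := by
    intro i j hij
    induction j, hij using Nat.le_induction with
    | base => exact fun _ => le_rfl
    | succ j hij ih => exact fun hj => (ih (by omega)).trans (hle j (by omega))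
  have h0 := (hc 0 (by omega)).2
  have h1 := (hc l hlk).2
  simp only [bandParity, Even.zero, hl, decide_true, decide_eq_true_eq] at h0 h1
  have hpar : ∀ i ≤ l, (Even (weightOn A (c i) / s) ↔ Even i) := by
    intro i hi
    have h2 := (hc i (by omega)).2
    have h3 := h0.1.1.trans (weightOn_mono Aᶜ (hmono 0 i (by omega) hi))
    have h4 := (weightOn_mono Aᶜ (hmono i l hi le_rfl)).trans h1.1.2
    simpa [bandParity, h3, h4] using h2
  have hidx : ∀ i ≤ l, weightOn A (c 0) / s + i ≤ weightOn A (c i) / s := by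
    intro i
    induction i with
    | zero => simp
    | succ i ih =>
      intro hi
      have h2 := ih (by omega)
      have h3 : weightOn A (c i) / s ≤ weightOn A (c (i + 1)) / s :=
        Nat.div_le_div_right (weightOn_mono A (hle i (by omega)))
      have h4 : weightOn A (c i) / s ≠ weightOn A (c (i + 1)) / s := by
        intro h
        have h5 := hpar i (by omega)
        have h6 := hpar (i + 1) hi
        rw [h, h6, Nat.even_add_one] at h5
        tauto
      omega
  have h0l := hmono 0 l (by omega) le_rfl
  have hA := weightOn_add_card_raised A h0l
  have hAc := weightOn_add_card_raised Aᶜ h0l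
  refine ⟨c 0, (hc 0 (by omega)).1, c l, (hc l hlk).1, ?_, ?_⟩
  -- Raising the quotient by `l` raises the weight by more than `(l - 1) * s ≥ k * s / 3 ≥ 12 * r`.
  · have h2 := hidx l le_rfl
    have h3 : s * (weightOn A (c l) / s) ≤ weightOn A (c l) := Nat.mul_div_le _ _
    have h4 : weightOn A (c 0) < s * (weightOn A (c 0) / s + 1) := by
      have := Nat.lt_mul_div_succ (weightOn A (c 0)) hs
      simpa using this
    have h5 : (raised (c 0) (c l) ∩ A).card ≤ (raised (c 0) (c l)).card :=
      Finset.card_le_card Finset.inter_subset_left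
    obtain ⟨p, rfl⟩ : ∃ p, l = p + 1 := ⟨l - 1, by omega⟩
    have h6 : s * (weightOn A (c 0) / s + 1) + s * p ≤ s * (weightOn A (c (p + 1)) / s) := by
      rw [← mul_add]
      exact Nat.mul_le_mul_left _ (by omega)
    have h7 : k * s ≤ 3 * (s * p) := by
      calc k * s ≤ (3 * p) * s := Nat.mul_le_mul_right _ (by omega)
        _ = _ := by ring
    omega
  · rw [Finset.sdiff_eq_inter_compl]
    omega

/-- Few of the functions `bandParity r s A` have an alternating chain inside a given query set. -/
theorem card_filter_hasAltChain_le {n k r s : ℕ} (hs : 0 < s) (hk : 2 ≤ k)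
    (hks : 36 * r ≤ k * s) (Q : List (Cube n)) (S : Finset (Finset (Fin n)))
    (hS : ∀ A ∈ S, ∃ z, HasAltChain (bandParity r s A) Q (k + 1) z) :
    (S.card : ℝ) ≤ (Q.length : ℝ) ^ 2 * (2 ^ n * ((3 / 4) ^ (12 * r) * 2 ^ r)) := by
  classical
  set P : Finset (Cube n × Cube n) :=
    (Q.toFinset ×ˢ Q.toFinset).filter fun p => 12 * r ≤ (raised p.1 p.2).card
  have hsub : S ⊆ P.biUnion fun p =>
      Finset.univ.filter fun A : Finset (Fin n) => (raised p.1 p.2 \ A).card ≤ r := by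
    intro A hA
    obtain ⟨z, hz⟩ := hS A hA
    obtain ⟨x, hx, y, hy, h1, h2⟩ := exists_raised_of_hasAltChain hs hk hks hz
    simp only [Finset.mem_biUnion, P, Finset.mem_filter, Finset.mem_product, List.mem_toFinset,
      Finset.mem_univ, true_and]
    exact ⟨(x, y), ⟨⟨hx, hy⟩, h1⟩, h2⟩
  have hP : P.card ≤ Q.length ^ 2 := by
    refine (Finset.card_filter_le _ _).trans ?_
    rw [Finset.card_product, sq]
    exact Nat.mul_le_mul Q.toFinset_card_le Q.toFinset_card_le
  calc (S.card : ℝ) ≤ ((P.biUnion fun p => Finset.univ.filter fun A : Finset (Fin n) =>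
        (raised p.1 p.2 \ A).card ≤ r).card : ℝ) := by exact_mod_cast Finset.card_le_card hsub
    _ ≤ ∑ p ∈ P, ((Finset.univ.filter fun A : Finset (Fin n) =>
        (raised p.1 p.2 \ A).card ≤ r).card : ℝ) := by exact_mod_cast Finset.card_biUnion_le
    _ ≤ P.card • (2 ^ n * ((3 / 4 : ℝ) ^ (12 * r) * 2 ^ r)) :=
        Finset.sum_le_card_nsmul _ _ _ fun p hp =>
          card_filter_sdiff_le _ (Finset.mem_filter.1 hp).2
    _ ≤ _ := by
      rw [nsmul_eq_mul]
      gcongr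
      exact_mod_cast hP

/-! ### Binomial coefficients near the centre -/

/-- Squaring makes the induction step polynomial: it reduces to `4(i+1)²(4i+1) ≤ (4i+5)(2i+1)²`,
where the two sides differ by `1`. -/
theorem sixteen_pow_le_centralBinom_sq (i : ℕ) :
    (16 : ℝ) ^ i ≤ (4 * i + 1) * (i.centralBinom : ℝ) ^ 2 := by
  induction i with
  | zero => simp
  | succ i ih =>
    have h : ((i : ℝ) + 1) * ((i + 1).centralBinom : ℝ) = 2 * (2 * i + 1) * i.centralBinom := by
      exact_mod_cast Nat.succ_mul_centralBinom_succ i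
    have hi : (0 : ℝ) < (i : ℝ) + 1 := by positivity
    refine le_of_mul_le_mul_right ?_ (pow_pos hi 2)
    calc (16 : ℝ) ^ (i + 1) * ((i : ℝ) + 1) ^ 2 = 16 * ((i : ℝ) + 1) ^ 2 * 16 ^ i := by ring
      _ ≤ 16 * ((i : ℝ) + 1) ^ 2 * ((4 * i + 1) * (i.centralBinom : ℝ) ^ 2) := by gcongr
      _ = (16 * ((i : ℝ) + 1) ^ 2 * (4 * i + 1)) * (i.centralBinom : ℝ) ^ 2 := by ring
      _ ≤ ((4 * (i + 1) + 1) * (2 * (2 * i + 1)) ^ 2) * (i.centralBinom : ℝ) ^ 2 := by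
        gcongr ?_ * _
        nlinarith [Nat.cast_nonneg (α := ℝ) i]
      _ = (4 * ((i : ℝ) + 1) + 1) * (2 * (2 * i + 1) * i.centralBinom) ^ 2 := by ring
      _ = (4 * ((i + 1 : ℕ) : ℝ) + 1) * ((i + 1).centralBinom : ℝ) ^ 2 * ((i : ℝ) + 1) ^ 2 := by
        rw [← h]; push_cast; ring

theorem two_pow_le_sqrt_mul_choose_half (m : ℕ) :
    (2 : ℝ) ^ m ≤ 4 * (Real.sqrt (m + 1) * (m.choose (m / 2) : ℝ)) := by
  have key : (4 : ℝ) ^ m ≤ 16 * ((m + 1) * (m.choose (m / 2) : ℝ) ^ 2) := by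
    obtain ⟨i, rfl | rfl⟩ := m.even_or_odd'
    · have h := sixteen_pow_le_centralBinom_sq i
      rw [Nat.mul_div_cancel_left i two_pos, pow_mul]
      rw [Nat.centralBinom] at h
      norm_num
      refine h.trans ?_
      rw [← mul_assoc]
      gcongr
      linarith [Nat.cast_nonneg (α := ℝ) i]
    · have h := sixteen_pow_le_centralBinom_sq i
      have h2 : (2 * i + 1) / 2 = i := by omega
      have h3 : i.centralBinom ≤ (2 * i + 1).choose i := by
        rw [Nat.centralBinom]
        exact Nat.choose_le_choose i (by omega)
      rw [h2, pow_succ, pow_mul]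
      norm_num
      calc (16 : ℝ) ^ i * 4 ≤ ((4 * i + 1) * (i.centralBinom : ℝ) ^ 2) * 4 := by gcongr
        _ ≤ ((4 * i + 1) * ((2 * i + 1).choose i : ℝ) ^ 2) * 4 := by gcongr
        _ = (16 * i + 4) * ((2 * i + 1).choose i : ℝ) ^ 2 := by ring
        _ ≤ (16 * (2 * i + 1 + 1)) * ((2 * i + 1).choose i : ℝ) ^ 2 := by
          gcongr ?_ * _
          linarith [Nat.cast_nonneg (α := ℝ) i]
        _ = _ := by ring
  refine le_of_sq_le_sq ?_ (by positivity)
  rw [mul_pow, mul_pow, Real.sq_sqrt (by positivity), ← pow_mul, mul_comm m 2, pow_mul]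
  norm_num
  exact key

theorem exp_neg_two_mul_le {x : ℝ} (h0 : 0 ≤ x) (h1 : x ≤ 1 / 2) :
    Real.exp (-(2 * x)) ≤ 1 - x := by
  rw [Real.exp_neg]
  refine inv_le_of_inv_le₀ (by linarith) ?_
  refine le_trans ?_ (Real.add_one_le_exp (2 * x))
  rw [inv_le_iff_one_le_mul₀ (by linarith)]
  nlinarith

/-- Binomial coefficients near the centre have the order of magnitude `2 ^ m / √m`. -/
theorem exists_local_choose_lower_bound (R : ℝ) (hR : 0 < R) :
    ∃ c : ℝ, 0 < c ∧ ∀ m i : ℕ, m / 2 + i ≤ m → (i : ℝ) ≤ R * Real.sqrt (m + 1) →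
      c * 2 ^ m ≤ Real.sqrt (m + 1) * (m.choose (m / 2 + i) : ℝ) := by
  -- For `m > M` the loss `x` per step below is at most `1/2`; for `m ≤ M` the constant `(1/2) ^ M`
  -- suffices.
  obtain ⟨M, hM⟩ := exists_nat_ge ((8 * (R + 1)) ^ 2)
  refine ⟨min ((1 / 2) ^ M) (Real.exp (-(8 * (R + 1) * R)) / 4), by positivity,
    fun m i him hi => ?_⟩
  have hsq : (0 : ℝ) ≤ Real.sqrt (m + 1) := Real.sqrt_nonneg _
  have hsq1 : (1 : ℝ) ≤ Real.sqrt (m + 1) := by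
    rw [Real.one_le_sqrt]; linarith [Nat.cast_nonneg (α := ℝ) m]
  have hss : Real.sqrt (m + 1) * Real.sqrt (m + 1) = m + 1 := Real.mul_self_sqrt (by positivity)
  rcases le_or_gt m M with hmM | hmM
  · have h1 : (1 : ℝ) ≤ (m.choose (m / 2 + i) : ℝ) := by exact_mod_cast Nat.choose_pos him
    calc _ ≤ (1 / 2 : ℝ) ^ M * 2 ^ m := by gcongr; exact min_le_left _ _
      _ ≤ (1 / 2 : ℝ) ^ m * 2 ^ m := by
        gcongr 1
        exact pow_le_pow_of_le_one (by norm_num) (by norm_num) hmM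
      _ = 1 := by rw [← mul_pow]; norm_num
      _ ≤ _ := by nlinarith
  · have hMm : (8 * (R + 1)) ^ 2 ≤ (m : ℝ) := hM.trans (by exact_mod_cast hmM.le)
    set x : ℝ := 4 * (R + 1) / Real.sqrt (m + 1) with hx
    have hpos : (0 : ℝ) < Real.sqrt (m + 1) := by linarith
    have hx0 : 0 ≤ x := by positivity
    have hx1 : x ≤ 1 / 2 := by
      rw [hx, div_le_iff₀ hpos]
      have : 8 * (R + 1) ≤ Real.sqrt (m + 1) := Real.le_sqrt_of_sq_le (by linarith)
      linarith
    -- Consecutive coefficients in this range have ratio at least `1 - x`, and at most `R * √(m +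
    -- 1)` steps lose only a constant factor.
    have step : ∀ j ≤ i, (1 - x) ^ j * (m.choose (m / 2) : ℝ) ≤ (m.choose (m / 2 + j) : ℝ) := by
      intro j
      induction j with
      | zero => simp
      | succ j ih =>
        intro hj
        have h1 := ih (by omega)
        have h2 : (m.choose (m / 2 + (j + 1)) : ℝ) * ((m / 2 + j : ℕ) + 1) =
            m.choose (m / 2 + j) * ((m : ℝ) - (m / 2 + j : ℕ)) := by
          have h := Nat.choose_succ_right_eq m (m / 2 + j)
          have h' : ((m - (m / 2 + j) : ℕ) : ℝ) = (m : ℝ) - (m / 2 + j : ℕ) :=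
            Nat.cast_sub (by omega)
          rw [← h']
          exact_mod_cast h
        have h3 : (1 - x) * (((m / 2 + j : ℕ) : ℝ) + 1) ≤ (m : ℝ) - (m / 2 + j : ℕ) := by
          have hj' : ((j : ℝ) + 1) ≤ R * Real.sqrt (m + 1) :=
            le_trans (by exact_mod_cast hj) hi
          have ha : (m : ℝ) ≤ 2 * ((m / 2 : ℕ) : ℝ) + 1 := by
            exact_mod_cast (by omega : m ≤ 2 * (m / 2) + 1)
          have hb : 2 * ((m / 2 : ℕ) : ℝ) ≤ m := by exact_mod_cast (by omega : 2 * (m / 2) ≤ m)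
          have hxm : x * ((m : ℝ) + 1) = 4 * (R + 1) * Real.sqrt (m + 1) := by
            rw [← div_mul_cancel₀ (4 * (R + 1)) hpos.ne', ← hx, mul_assoc, hss]
          have hxh : 2 * (R + 1) * Real.sqrt (m + 1) ≤ x * (((m / 2 + j : ℕ) : ℝ) + 1) := by
            have : x * (((m : ℝ) + 1) / 2) ≤ x * (((m / 2 + j : ℕ) : ℝ) + 1) := by
              gcongr
              push_cast
              linarith [Nat.cast_nonneg (α := ℝ) j]
            linarith
          push_cast at hxh ⊢
          nlinarith
        have hd : (0 : ℝ) < ((m / 2 + j : ℕ) : ℝ) + 1 := by positivity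
        refine le_of_mul_le_mul_right ?_ hd
        rw [h2]
        have hnn : (0 : ℝ) ≤ (1 - x) * (((m / 2 + j : ℕ) : ℝ) + 1) :=
          mul_nonneg (by linarith) hd.le
        calc (1 - x) ^ (j + 1) * (m.choose (m / 2) : ℝ) * (((m / 2 + j : ℕ) : ℝ) + 1)
            = ((1 - x) ^ j * (m.choose (m / 2) : ℝ)) *
              ((1 - x) * (((m / 2 + j : ℕ) : ℝ) + 1)) := by ring
          _ ≤ _ := mul_le_mul h1 h3 hnn (by positivity)
    have hexp : Real.exp (-(8 * (R + 1) * R)) ≤ (1 - x) ^ i := by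
      calc Real.exp (-(8 * (R + 1) * R)) ≤ Real.exp ((i : ℝ) * -(2 * x)) := by
            apply Real.exp_le_exp.2
            have : (i : ℝ) * x ≤ R * Real.sqrt (m + 1) * x := by gcongr
            have h2 : R * Real.sqrt (m + 1) * x = 4 * (R + 1) * R := by
              rw [hx]; field_simp
            linarith
        _ = Real.exp (-(2 * x)) ^ i := Real.exp_nat_mul _ _
        _ ≤ _ := pow_le_pow_left₀ (Real.exp_pos _).le (exp_neg_two_mul_le hx0 hx1) i
    calc _ ≤ Real.exp (-(8 * (R + 1) * R)) / 4 * 2 ^ m := by gcongr; exact min_le_right _ _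
      _ ≤ Real.exp (-(8 * (R + 1) * R)) / 4 *
          (4 * (Real.sqrt (m + 1) * (m.choose (m / 2) : ℝ))) := by
        gcongr; exact two_pow_le_sqrt_mul_choose_half m
      _ = Real.sqrt (m + 1) * (Real.exp (-(8 * (R + 1) * R)) * (m.choose (m / 2) : ℝ)) := by ring
      _ ≤ Real.sqrt (m + 1) * ((1 - x) ^ i * (m.choose (m / 2) : ℝ)) := by gcongr
      _ ≤ _ := by gcongr; exact step i le_rfl

/-! ### Errors along chains and averaging over maximal chains -/

/-- A sequence that alternates along fewer than `k + 1` increasing indices is far from the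
sequence of blocks of length `s` of alternating values. -/
theorem le_card_filter_ne_even_div {k s t M : ℕ} (hs : 0 < s) (G : ℕ → Bool)
    (hM : 2 * s * (t + 2 * k) ≤ M)
    (hG : ∀ p : Fin (k + 1) → ℕ, StrictMono p → (∀ i, p i < M) →
      ¬ ∀ i, G (p i) = decide (Even (i : ℕ))) :
    k * s ≤ ((Finset.Ico (2 * s * t) (2 * s * (t + 2 * k))).filter
      fun j => G j ≠ decide (Even (j / s))).card := by
  classical
  -- Each `block` joins two adjacent blocks of length `s`. If `G` took both values on `k + 1` of the
  -- `2 * k` double blocks, a forbidden alternating sequence could be picked from them. So `G` is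
  -- constant on at least `k`, each contributing `s` errors.
  set block : ℕ → Finset ℕ := fun p => Finset.Ico (2 * s * p) (2 * s * (p + 1)) with hblock
  set P := (Finset.Ico t (t + 2 * k)).filter fun p => ∀ b, ∃ j ∈ block p, G j = b with hP
  have hPk : P.card ≤ k := by
    by_contra! hcard
    set e := P.orderEmbOfCardLe hcard
    have he : ∀ i, e i ∈ P := P.orderEmbOfCardLe_mem hcard
    have hmem : ∀ p, p ∈ P → ∀ b, ∃ j ∈ block p, G j = b := fun p hp => (Finset.mem_filter.1 hp).2
    choose! φ hφ hφ' using hmem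
    refine hG (fun i => φ (e i) (decide (Even (i : ℕ)))) (fun i j hij => ?_) (fun i => ?_)
      fun i => hφ' _ (he i) _
    · have h1 := Finset.mem_Ico.1 (hφ _ (he i) (decide (Even (i : ℕ))))
      have h2 := Finset.mem_Ico.1 (hφ _ (he j) (decide (Even (j : ℕ))))
      have h3 : 2 * s * (e i + 1) ≤ 2 * s * e j := Nat.mul_le_mul_left _ (e.strictMono hij)
      exact h1.2.trans_le (h3.trans h2.1)
    · have h1 := Finset.mem_Ico.1 (hφ _ (he i) (decide (Even (i : ℕ))))
      have h2 := Finset.mem_Ico.1 (Finset.mem_filter.1 (he i)).1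
      have h3 : 2 * s * (e i + 1) ≤ 2 * s * (t + 2 * k) := Nat.mul_le_mul_left _ h2.2
      exact h1.2.trans_le (h3.trans hM)
  set C := (Finset.Ico t (t + 2 * k)) \ P with hC
  have hCk : k ≤ C.card := by
    have := Finset.le_card_sdiff P (Finset.Ico t (t + 2 * k))
    rw [Nat.card_Ico, ← hC] at this
    omega
  have hconst : ∀ p ∈ C, ∀ j ∈ block p, G j = G (2 * s * p) := by
    intro p hp j hj
    have hp' := Finset.mem_sdiff.1 hp
    by_contra hne
    refine hp'.2 (Finset.mem_filter.2 ⟨hp'.1, fun b => ?_⟩)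
    by_cases hb : G j = b
    · exact ⟨j, hj, hb⟩
    · refine ⟨2 * s * p, Finset.mem_Ico.2 ⟨le_rfl, Nat.mul_lt_mul_of_pos_left (by omega) (by omega)⟩, ?_⟩
      cases b <;> simp_all
  -- Selects the half of a double block whose prescribed value differs from the constant value of
  -- `G`.
  set off : ℕ → ℕ := fun p => if G (2 * s * p) then 1 else 0 with hoff
  have hoff1 : ∀ p, off p ≤ 1 := fun p => by simp only [hoff]; split_ifs <;> simp
  have hidx : ∀ p i, i < s → (s * (2 * p + off p) + i) / s = 2 * p + off p := by
    intro p i hi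
    rw [Nat.mul_add_div hs, Nat.div_eq_of_lt hi, add_zero]
  have hblk : ∀ p i, i < s → s * (2 * p + off p) + i ∈ block p := by
    intro p i hi
    have h1 : s * off p ≤ s * 1 := Nat.mul_le_mul_left _ (hoff1 p)
    simp only [hblock, Finset.mem_Ico]
    constructor <;> nlinarith
  calc k * s ≤ (C ×ˢ Finset.range s).card := by
        rw [Finset.card_product, Finset.card_range]
        exact Nat.mul_le_mul_right _ hCk
    _ ≤ _ := by
      refine Finset.card_le_card_of_injOn (fun q => s * (2 * q.1 + off q.1) + q.2) ?_ ?_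
      · rintro ⟨p, i⟩ hq
        simp only [Finset.coe_product, Set.mem_prod, Finset.mem_coe, Finset.mem_range] at hq
        obtain ⟨hp, hi⟩ := hq
        have h1 := hblk p i hi
        have h2 := Finset.mem_Ico.1 h1
        have h3 := Finset.mem_Ico.1 (Finset.mem_sdiff.1 hp).1
        have h4 : 2 * s * t ≤ 2 * s * p := Nat.mul_le_mul_left _ h3.1
        have h5 : 2 * s * (p + 1) ≤ 2 * s * (t + 2 * k) := Nat.mul_le_mul_left _ h3.2
        simp only [Finset.coe_filter, Set.mem_ofPred_eq, Finset.mem_Ico]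
        refine ⟨⟨h4.trans h2.1, h2.2.trans_le h5⟩, ?_⟩
        rw [hconst p hp _ h1, hidx p i hi]
        simp only [hoff]
        by_cases hG : G (2 * s * p) <;> simp [hG]
      · rintro ⟨p, i⟩ hq ⟨p', i'⟩ hq' heq
        simp only [Finset.coe_product, Set.mem_prod, Finset.mem_coe, Finset.mem_range] at hq hq'
        have h1 := hidx p i hq.2
        have h2 := hidx p' i' hq'.2
        simp only at heq
        rw [heq, h2] at h1
        have := hoff1 p
        have := hoff1 p'
        obtain rfl : p = p' := by omega
        simpa using heq

/-- The initial segment of length `j` of a numbering. -/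
def initialSegment {α : Type*} [Fintype α] (ν : Numbering α) (j : ℕ) : Finset α :=
  Finset.univ.filter fun a => (ν a : ℕ) < j

theorem card_initialSegment {α : Type*} [Fintype α] (ν : Numbering α) {j : ℕ}
    (hj : j ≤ Fintype.card α) : (initialSegment ν j).card = j := by
  classical
  have h : (initialSegment ν j).map ν.toEmbedding =
      Finset.univ.filter fun i : Fin (Fintype.card α) => (i : ℕ) < j := by
    ext i
    simp [initialSegment]
  rw [← Finset.card_map ν.toEmbedding, h, Fin.card_filter_val_lt]
  exact min_eq_right hj

theorem isPrefix_initialSegment {α : Type*} [Fintype α] (ν : Numbering α) {j : ℕ}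
    (hj : j ≤ Fintype.card α) : ν.IsPrefix (initialSegment ν j) := fun a => by
  rw [card_initialSegment ν hj]
  simp [initialSegment]

theorem initialSegment_ssubset {α : Type*} [Fintype α] (ν : Numbering α) {i j : ℕ} (hij : i < j)
    (hj : j ≤ Fintype.card α) : initialSegment ν i ⊂ initialSegment ν j := by
  rw [Finset.ssubset_iff_subset_ne]
  refine ⟨fun a ha => ?_, fun h => ?_⟩
  · simp only [initialSegment, Finset.mem_filter, Finset.mem_univ, true_and] at ha ⊢
    omega
  · have := congrArg Finset.card h
    rw [card_initialSegment ν hj, card_initialSegment ν (by omega)] at this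
    omega

/-- A function on the subsets of `α` without alternating chain of `k + 1` points differs often
from the function that alternates with the cardinality in steps of length `s`. -/
theorem le_card_filter_ne_even_card_div {α : Type*} [Fintype α] {k s t : ℕ} {c : ℝ} (hs : 0 < s)
    (g : Finset α → Bool)
    (hg : ∀ z : Fin (k + 1) → Finset α, StrictMono z → ¬ ∀ i, g (z i) = decide (Even (i : ℕ)))
    (ht : 2 * s * (t + 2 * k) ≤ Fintype.card α)
    (hc : ∀ j ∈ Finset.Ico (2 * s * t) (2 * s * (t + 2 * k)), c * 2 ^ Fintype.card α ≤
      Real.sqrt (Fintype.card α + 1) * ((Fintype.card α).choose j : ℝ)) :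
    c * 2 ^ Fintype.card α * (k * s) ≤ Real.sqrt (Fintype.card α + 1) *
      ((Finset.univ.filter fun z : Finset α => g z ≠ decide (Even (z.card / s))).card : ℝ) := by
  classical
  set m := Fintype.card α with hm
  set W : Finset (Finset α) := Finset.univ.filter fun z =>
    z.card ∈ Finset.Ico (2 * s * t) (2 * s * (t + 2 * k)) ∧ g z ≠ decide (Even (z.card / s))
  -- The initial segments of a numbering form a maximal chain.
  have hν : ∀ ν : Numbering α, k * s ≤ (W.filter fun z => ν.IsPrefix z).card := by
    intro ν
    refine (le_card_filter_ne_even_div (t := t) hs (fun j => g (initialSegment ν j)) ht ?_).trans ?_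
    · intro p hp hpm
      refine hg (fun i => initialSegment ν (p i)) fun i j hij => ?_
      exact initialSegment_ssubset ν (hp hij) (hpm j).le
    · refine Finset.card_le_card_of_injOn (fun j => initialSegment ν j) (fun j hj => ?_) ?_
      · rw [Finset.mem_coe, Finset.mem_filter] at hj
        have hjm : j ≤ m := (Finset.mem_Ico.1 hj.1).2.le.trans ht
        simp only [W, Finset.coe_filter, Finset.mem_filter, Finset.mem_univ, true_and,
          Set.mem_ofPred_eq, card_initialSegment ν hjm]
        exact ⟨hj, isPrefix_initialSegment ν hjm⟩
      · intro i hi j hj hij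
        rw [Finset.mem_coe, Finset.mem_filter, Finset.mem_Ico] at hi hj
        have := congrArg Finset.card hij
        rwa [card_initialSegment ν (by omega), card_initialSegment ν (by omega)] at this
  have hswap : ∑ ν : Numbering α, (W.filter fun z => ν.IsPrefix z).card =
      ∑ z ∈ W, (Numbering.prefixed z).card :=
    Finset.sum_card_bipartiteAbove_eq_sum_card_bipartiteBelow (fun ν z => Numbering.IsPrefix ν z)
  have hlow : m.factorial * (k * s) ≤ ∑ z ∈ W, (Numbering.prefixed z).card := by
    rw [← hswap]
    calc m.factorial * (k * s) = ∑ ν : Numbering α, k * s := by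
          rw [Finset.sum_const, Finset.card_univ, Fintype.card_numbering, smul_eq_mul]
      _ ≤ _ := Finset.sum_le_sum fun ν _ => hν ν
  -- A set of size `j` is a prefix of `j! (m - j)! = m! / (m.choose j)` numberings, so large
  -- binomial coefficients limit the weight of each bad set.
  have hup : ∀ z ∈ W, c * 2 ^ m * ((Numbering.prefixed z).card : ℝ) ≤
      Real.sqrt (m + 1) * m.factorial := by
    intro z hz
    have h1 := hc _ (Finset.mem_filter.1 hz).2.1
    rw [Numbering.card_prefixed, ← Nat.choose_mul_factorial_mul_factorial z.card_le_univ]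
    push_cast
    calc _ ≤ Real.sqrt (m + 1) * (m.choose z.card : ℝ) *
          ((z.card.factorial : ℝ) * ((m - z.card).factorial : ℝ)) := by gcongr
      _ = _ := by simp only [hm]; ring
  have hWle : (W.card : ℝ) ≤ ((Finset.univ.filter fun z : Finset α =>
      g z ≠ decide (Even (z.card / s))).card : ℝ) := by
    refine Nat.cast_le.2 (Finset.card_le_card fun z hz => ?_)
    exact Finset.mem_filter.2 ⟨Finset.mem_univ z, (Finset.mem_filter.1 hz).2.2⟩
  have hfac : (0 : ℝ) < m.factorial := by exact_mod_cast m.factorial_pos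
  rcases le_or_gt c 0 with hc0 | hc0
  · exact (mul_nonpos_of_nonpos_of_nonneg (mul_nonpos_of_nonpos_of_nonneg hc0 (by positivity))
      (by positivity)).trans (by positivity)
  refine le_of_mul_le_mul_right ?_ hfac
  calc c * 2 ^ m * (k * s) * m.factorial = c * 2 ^ m * ((m.factorial * (k * s) : ℕ) : ℝ) := by
        push_cast; ring
    _ ≤ c * 2 ^ m * ((∑ z ∈ W, (Numbering.prefixed z).card : ℕ) : ℝ) := by
        gcongr
    _ = ∑ z ∈ W, c * 2 ^ m * ((Numbering.prefixed z).card : ℝ) := by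
        push_cast; rw [Finset.mul_sum]
    _ ≤ W.card • (Real.sqrt (m + 1) * m.factorial) := Finset.sum_le_card_nsmul _ _ _ hup
    _ = Real.sqrt (m + 1) * W.card * m.factorial := by rw [nsmul_eq_mul]; ring
    _ ≤ _ := by gcongr

/-- A constant fraction of all subsets has a cardinality in the central band. -/
theorem exists_central_band_lower_bound :
    ∃ c : ℝ, 0 < c ∧ ∀ (β : Type) [Fintype β] (r : ℕ), Nat.sqrt (Fintype.card β) ≤ r →
      c * 2 ^ Fintype.card β ≤ ((Finset.univ.filter fun y : Finset β =>
        Fintype.card β / 2 ≤ y.card ∧ y.card ≤ Fintype.card β / 2 + r).card : ℝ) := by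
  classical
  obtain ⟨c, hc, h⟩ := exists_local_choose_lower_bound 1 one_pos
  refine ⟨c, hc, fun β _ r hr => ?_⟩
  set m := Fintype.card β with hm
  set q := Nat.sqrt m with hq
  have hq1 : q * q ≤ m := Nat.sqrt_le m
  have hq2 : m < (q + 1) * (q + 1) := Nat.lt_succ_sqrt m
  have hqm : ∀ i ∈ Finset.range (q + 1), m / 2 + i ≤ m := by
    intro i hi
    have hi := Finset.mem_range.1 hi
    have h2q : 2 * q ≤ m + 1 := by nlinarith [sq_nonneg ((q : ℤ) - 1)]
    omega
  have hqs : (q : ℝ) ≤ Real.sqrt (m + 1) := by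
    apply Real.le_sqrt_of_sq_le
    rw [sq]
    have : (q : ℝ) * q ≤ m := by exact_mod_cast hq1
    linarith
  have hsq : Real.sqrt (m + 1) ≤ q + 1 := by
    rw [Real.sqrt_le_left (by positivity), sq]
    exact_mod_cast hq2
  -- The `q + 1 ≥ √(m + 1)` levels from the centre upwards already suffice, each having measure at
  -- least `c / √(m + 1)`.
  have hsub : (Finset.range (q + 1)).biUnion (fun i =>
      Finset.powersetCard (m / 2 + i) (Finset.univ : Finset β)) ⊆
      Finset.univ.filter fun y : Finset β => m / 2 ≤ y.card ∧ y.card ≤ m / 2 + r := by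
    intro y hy
    obtain ⟨i, hi, hy⟩ := Finset.mem_biUnion.1 hy
    have hi := Finset.mem_range.1 hi
    have hy := (Finset.mem_powersetCard.1 hy).2
    simp only [Finset.mem_filter, Finset.mem_univ, true_and]
    omega
  have hcard := Finset.card_le_card hsub
  rw [Finset.card_biUnion fun i _ j _ hij => Finset.pairwise_disjoint_powersetCard _ (by omega)]
    at hcard
  simp only [Finset.card_powersetCard, Finset.card_univ, ← hm] at hcard
  refine le_trans ?_ (Nat.cast_le.2 hcard)
  have hpos : (0 : ℝ) < Real.sqrt (m + 1) := Real.sqrt_pos.2 (by positivity)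
  refine le_of_mul_le_mul_left ?_ hpos
  calc Real.sqrt (m + 1) * (c * 2 ^ m) ≤ (q + 1) * (c * 2 ^ m) := by gcongr
    _ = (Finset.range (q + 1)).card • (c * 2 ^ m) := by simp
    _ ≤ ∑ i ∈ Finset.range (q + 1), Real.sqrt (m + 1) * (m.choose (m / 2 + i) : ℝ) := by
      refine Finset.card_nsmul_le_sum _ _ _ fun i hi => h m i (hqm i hi) ?_
      rw [one_mul]
      refine le_trans ?_ hqs
      exact_mod_cast Nat.lt_succ_iff.1 (Finset.mem_range.1 hi)
    _ = _ := by rw [← Finset.mul_sum]; push_cast; rfl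

/-! ### Fibres of the cube and distance of the hard functions -/

/-- The point of the cube with support `z` on `A` and support `y` outside `A`. -/
def glue {n : ℕ} (A : Finset (Fin n)) (y : Finset {i // i ∈ Aᶜ}) (z : Finset {i // i ∈ A}) :
    Cube n := fun i =>
  if h : i ∈ A then decide (⟨i, h⟩ ∈ z) else decide (⟨i, Finset.mem_compl.2 h⟩ ∈ y)

section glue

variable {n : ℕ} {A : Finset (Fin n)}

theorem weightOn_glue (y : Finset {i // i ∈ Aᶜ}) (z : Finset {i // i ∈ A}) :
    weightOn A (glue A y z) = z.card := by
  rw [← Finset.card_map (Function.Embedding.subtype (· ∈ A)), weightOn]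
  congr 1
  ext i
  rw [Finset.mem_filter]
  by_cases h : i ∈ A <;> simp [glue, h]

theorem weightOn_compl_glue (y : Finset {i // i ∈ Aᶜ}) (z : Finset {i // i ∈ A}) :
    weightOn Aᶜ (glue A y z) = y.card := by
  rw [← Finset.card_map (Function.Embedding.subtype (· ∈ Aᶜ)), weightOn]
  congr 1
  ext i
  rw [Finset.mem_filter]
  by_cases h : i ∈ A <;> simp [glue, h]

theorem glue_injective :
    Function.Injective fun p : Finset {i // i ∈ Aᶜ} × Finset {i // i ∈ A} => glue A p.1 p.2 := by
  rintro ⟨y, z⟩ ⟨y', z'⟩ h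
  refine Prod.ext ?_ ?_
  · ext ⟨i, hi⟩
    have h1 := congrFun h i
    have h2 := Finset.mem_compl.1 hi
    simpa [glue, h2] using h1
  · ext ⟨i, hi⟩
    have h1 := congrFun h i
    simpa [glue, hi] using h1

theorem strictMono_glue (y : Finset {i // i ∈ Aᶜ}) : StrictMono (glue A y) := by
  refine Monotone.strictMono_of_injective (fun z z' h i => ?_) fun z z' h => ?_
  · rw [Bool.le_iff_imp]
    by_cases hi : i ∈ A
    · simpa [glue, hi] using fun h' => h h'
    · simp [glue, hi]
  · exact (Prod.ext_iff.1 (glue_injective (a₁ := (y, z)) (a₂ := (y, z')) h)).2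

theorem bandParity_glue {r s : ℕ} {y : Finset {i // i ∈ Aᶜ}} (z : Finset {i // i ∈ A})
    (hy : Aᶜ.card / 2 ≤ y.card ∧ y.card ≤ Aᶜ.card / 2 + r) :
    bandParity r s A (glue A y z) = decide (Even (z.card / s)) := by
  simp [bandParity, weightOn_glue, weightOn_compl_glue, hy]

end glue

theorem not_alternating_of_mem_kMonotone {n k : ℕ} {g : Cube n → Bool} (hg : g ∈ kMonotone n k)
    {x : Fin (k + 1) → Cube n} (hx : StrictMono x) : ¬ ∀ i, g (x i) = decide (Even (i : ℕ)) := by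
  intro h
  refine hg ⟨x, hx, by simp [h], fun i => ?_⟩
  rw [h, h]
  by_cases hi : Even (i : ℕ) <;> simp [hi, Nat.even_add_one]

theorem exists_le_distToProperty_bandParity :
    ∃ ε₀ : ℝ, 0 < ε₀ ∧ ε₀ ≤ 1 ∧ ∀ n k : ℕ, 888 ≤ Nat.sqrt n → 2 ≤ k → k ≤ Nat.sqrt n →
      ∀ A : Finset (Fin n), n ≤ 2 * A.card →
        ε₀ ≤ distToProperty (bandParity (Nat.sqrt n) (36 * Nat.sqrt n / k + 1) A)
          (kMonotone n k) := by
  classical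
  -- The window of levels ends at most `2 * s + 4 * k * s ≤ 5 * 37 * r` above `m / 2`; this is
  -- relaxed to `222 * r`, and `r ≤ 2 * √(m + 1)` gives `444`.
  obtain ⟨c₁, hc₁, h₁⟩ := exists_local_choose_lower_bound 444 (by norm_num)
  obtain ⟨c₂, hc₂, h₂⟩ := exists_central_band_lower_bound
  refine ⟨min 1 (c₁ * c₂), by positivity, min_le_left _ _, fun n k hr hk hkr A hA => ?_⟩
  set r := Nat.sqrt n with hrn
  set s := 36 * r / k + 1 with hs
  set m := A.card with hm
  have hr1 : r * r ≤ n := Nat.sqrt_le n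
  have hr2 : n < (r + 1) * (r + 1) := Nat.lt_succ_sqrt n
  have hmn : m ≤ n := by simpa using A.card_le_univ
  have hks : 36 * r ≤ k * s := (Nat.lt_mul_div_succ (36 * r) (by omega : 0 < k)).le
  have hks' : k * s ≤ 37 * r := by
    have := Nat.mul_div_le (36 * r) k
    rw [hs, mul_add]
    omega
  have hs2 : 2 * s ≤ k * s := Nat.mul_le_mul_right _ hk
  have hs0 : 0 < s := Nat.succ_pos _
  obtain ⟨t, ht1, ht2⟩ : ∃ t, m / 2 ≤ 2 * s * t ∧ 2 * s * t ≤ m / 2 + 2 * s := by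
    refine ⟨m / (4 * s) + 1, ?_, ?_⟩
    · have := Nat.lt_mul_div_succ m (by omega : 0 < 4 * s)
      have h4 : 4 * s * (m / (4 * s) + 1) = 2 * (2 * s * (m / (4 * s) + 1)) := by ring
      omega
    · have := Nat.mul_div_le m (4 * s)
      have h4 : 4 * s * (m / (4 * s)) = 2 * (2 * s * (m / (4 * s))) := by ring
      rw [mul_add]
      omega
  have hup : 2 * s * (t + 2 * k) ≤ m / 2 + 222 * r := by
    have : 2 * s * (t + 2 * k) = 2 * s * t + 4 * (k * s) := by ring
    omega
  -- Here `r ≥ 888` enters, through `m ≥ r ^ 2 / 2 ≥ 444 * r`.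
  have hrm : m / 2 + 222 * r ≤ m := by
    have : 888 * r ≤ r * r := Nat.mul_le_mul_right _ hr
    omega
  have hsq0 : (0 : ℝ) < Real.sqrt (m + 1) := Real.sqrt_pos.2 (by positivity)
  have hrs : (r : ℝ) ≤ 2 * Real.sqrt (m + 1) := by
    refine le_of_sq_le_sq ?_ (by positivity)
    rw [mul_pow, Real.sq_sqrt (by positivity)]
    have : ((r * r : ℕ) : ℝ) ≤ ((2 * m : ℕ) : ℝ) := by exact_mod_cast hr1.trans hA
    push_cast at this
    nlinarith [Nat.cast_nonneg (α := ℝ) m]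
  have hsr : Real.sqrt (m + 1) ≤ k * s := by
    have h3 : Real.sqrt (m + 1) ≤ r + 1 := by
      rw [Real.sqrt_le_left (by positivity), sq]
      exact_mod_cast (by omega : m + 1 ≤ (r + 1) * (r + 1))
    have h4 : ((r + 1 : ℕ) : ℝ) ≤ ((k * s : ℕ) : ℝ) := by
      exact_mod_cast (by omega : r + 1 ≤ k * s)
    push_cast at h4
    linarith
  refine le_csInf ((kMonotone_nonempty n k).image _) ?_
  rintro _ ⟨g, hg, rfl⟩
  set band := Finset.univ.filter fun y : Finset {i // i ∈ Aᶜ} =>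
    Aᶜ.card / 2 ≤ y.card ∧ y.card ≤ Aᶜ.card / 2 + r
  set wrong : Finset {i // i ∈ Aᶜ} → Finset (Finset {i // i ∈ A}) := fun y =>
    Finset.univ.filter fun z => g (glue A y z) ≠ decide (Even (z.card / s))
  have hband : c₂ * 2 ^ Aᶜ.card ≤ (band.card : ℝ) := by
    have h3 := h₂ {i // i ∈ Aᶜ} r (by
      rw [Fintype.card_coe]
      exact Nat.sqrt_le_sqrt (by simpa using Aᶜ.card_le_univ))
    simpa only [Fintype.card_coe] using h3
  have hwrong : ∀ y, c₁ * 2 ^ m ≤ ((wrong y).card : ℝ) := by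
    intro y
    have h3 := le_card_filter_ne_even_card_div (α := {i // i ∈ A}) (k := k) (s := s) (t := t)
      (c := c₁) hs0 (fun z => g (glue A y z))
      (fun z hz => not_alternating_of_mem_kMonotone hg ((strictMono_glue y).comp hz))
      (by rw [Fintype.card_coe]; exact hup.trans hrm) (by
        rw [Fintype.card_coe]
        intro j hj
        obtain ⟨hj1, hj2⟩ := Finset.mem_Ico.1 hj
        obtain ⟨i, rfl⟩ := Nat.exists_eq_add_of_le (ht1.trans hj1)
        refine h₁ m i (by omega) ?_
        have h4 : (i : ℝ) ≤ 222 * r := by exact_mod_cast (by omega : i ≤ 222 * r)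
        linarith)
    rw [Fintype.card_coe] at h3
    refine le_of_mul_le_mul_left ?_ hsq0
    refine le_trans ?_ h3
    rw [mul_comm]
    gcongr
  have hcount : ((band.sigma wrong).card : ℝ) ≤
      ((Finset.univ.filter fun x : Cube n => bandParity r s A x ≠ g x).card : ℝ) := by
    refine Nat.cast_le.2 (Finset.card_le_card_of_injOn (fun p => glue A p.1 p.2) ?_ ?_)
    · rintro ⟨y, z⟩ hp
      rw [Finset.mem_coe, Finset.mem_sigma] at hp
      have h3 := (Finset.mem_filter.1 hp.1).2
      have h4 := (Finset.mem_filter.1 hp.2).2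
      simp only [Finset.coe_filter, Finset.mem_univ, true_and, Set.mem_ofPred_eq]
      rw [bandParity_glue z h3]
      exact h4.symm
    · rintro ⟨y, z⟩ - ⟨y', z'⟩ - h
      have := glue_injective (a₁ := (y, z)) (a₂ := (y', z')) h
      simp_all
  refine (min_le_right _ _).trans ?_
  rw [cubeDist, le_div_iff₀ (by positivity)]
  refine le_trans ?_ hcount
  rw [Finset.card_sigma]
  push_cast
  have hn : m + Aᶜ.card = n := by rw [hm, Finset.card_add_card_compl, Fintype.card_fin]
  have h2n : (2 : ℝ) ^ n = 2 ^ m * 2 ^ Aᶜ.card := by rw [← pow_add, hn]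
  calc c₁ * c₂ * 2 ^ n = (c₂ * 2 ^ Aᶜ.card) * (c₁ * 2 ^ m) := by
        rw [h2n]; ring
    _ ≤ (band.card : ℝ) * (c₁ * 2 ^ m) := by gcongr
    _ = band.card • (c₁ * 2 ^ m) := by rw [nsmul_eq_mul]
    _ ≤ _ := Finset.card_nsmul_le_sum _ _ _ fun y _ => hwrong y

/-! ### From testers to the query bound -/

/-- A one-sided tester rejects only if it queries an alternating chain. -/
theorem exists_hasAltChain_of_reject {n k : ℕ} {Ω : Type*} [MeasurableSpace Ω]
    {T : NonAdaptiveAlgorithm n Ω} {ω : Ω} (hω : ∀ g ∈ kMonotone n k, T.output g ω = true)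
    {f : Cube n → Bool} (hf : T.output f ω = false) :
    ∃ z, HasAltChain f (T.queries ω) (k + 1) z := by
  by_contra! h
  obtain ⟨g, hg, hgf⟩ := exists_kMonotone_extension f (T.queries ω) h
  have h1 := hω g hg
  rw [NonAdaptiveAlgorithm.output, List.map_congr_left hgf] at h1
  exact Bool.false_ne_true (hf.symm.trans h1)

/-- If all functions of a family are rejected with probability at least `2 / 3`, then some outcome
rejects two thirds of the family. -/
theorem two_thirds_mul_card_le {Ω ι : Type*} [MeasurableSpace Ω] (μ : Measure Ω)
    [IsProbabilityMeasure μ] (S : Finset ι) (E : ι → Set Ω) (hE : ∀ i, MeasurableSet (E i))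
    (hμ : ∀ i ∈ S, 2 / 3 ≤ μ (E i)) {K : ℝ}
    (hK : ∀ᵐ ω ∂μ, ∀ S' ⊆ S, (∀ i ∈ S', ω ∈ E i) → (S'.card : ℝ) ≤ K) :
    2 / 3 * (S.card : ℝ) ≤ K := by
  classical
  have hK0 : 0 ≤ K := by
    obtain ⟨ω, hω⟩ := hK.exists
    simpa using hω ∅ (Finset.empty_subset _) (by simp)
  -- The expected number of rejected members is at least `2/3 * S.card`, but almost surely at most
  -- `K` are rejected.
  have h1 : (S.card : ENNReal) * (2 / 3) ≤ ∑ i ∈ S, μ (E i) := by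
    rw [← nsmul_eq_mul]
    exact Finset.card_nsmul_le_sum _ _ _ hμ
  have h2 : ∑ i ∈ S, μ (E i) = ∫⁻ ω, ∑ i ∈ S, (E i).indicator 1 ω ∂μ := by
    rw [lintegral_finsetSum _ fun i _ => measurable_one.indicator (hE i)]
    exact Finset.sum_congr rfl fun i _ => (lintegral_indicator_one (hE i)).symm
  have h3 : ∫⁻ ω, ∑ i ∈ S, (E i).indicator 1 ω ∂μ ≤ ∫⁻ _, ENNReal.ofReal K ∂μ := by
    refine lintegral_mono_ae (hK.mono fun ω hω => ?_)
    have h4 := hω (S.filter fun i => ω ∈ E i) (Finset.filter_subset _ _)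
      fun i hi => (Finset.mem_filter.1 hi).2
    have h5 : ∑ i ∈ S, (E i).indicator (1 : Ω → ENNReal) ω =
        ((S.filter fun i => ω ∈ E i).card : ENNReal) := by
      simp [Set.indicator_apply]
    rw [h5, ← ENNReal.ofReal_natCast]
    exact ENNReal.ofReal_le_ofReal h4
  rw [lintegral_const, measure_univ, mul_one] at h3
  have h4 := h1.trans (h2.le.trans h3)
  have h5 := ENNReal.toReal_mono ENNReal.ofReal_ne_top h4
  rw [ENNReal.toReal_ofReal hK0] at h5
  simp at h5
  linarith

theorem half_mul_exp_half_sqrt_le {n k r s q : ℕ} {ε : ℝ} {Ω : Type*} [MeasurableSpace Ω]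
    {μ : Measure Ω} [IsProbabilityMeasure μ] {T : NonAdaptiveAlgorithm n Ω} (hr : 1 ≤ r)
    (hnr : n < (r + 1) * (r + 1)) (hs : 0 < s) (hk : 2 ≤ k) (hks : 36 * r ≤ k * s)
    (hfar : ∀ A : Finset (Fin n), n ≤ 2 * A.card →
      ε ≤ distToProperty (bandParity r s A) (kMonotone n k))
    (hT : T.IsOneSidedTester μ (kMonotone n k) ε) (hq : T.QueriesAtMost q) :
    1 / 2 * Real.exp (Real.sqrt n / 2) ≤ q := by
  classical
  set S := Finset.univ.filter fun A : Finset (Fin n) => n ≤ 2 * A.card with hS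
  -- There are finitely many `g`, so the exceptional null sets can be united.
  have hae : ∀ᵐ ω ∂μ, ∀ g ∈ kMonotone n k, T.output g ω = true := by
    rw [ae_ball_iff (Set.to_countable _)]
    exact fun g hg => (mem_ae_iff_prob_eq_one (T.measurableSet_accept g)).2 (hT.1 g hg)
  have hmain := two_thirds_mul_card_le μ S
    (fun A => {ω | T.output (bandParity r s A) ω = false})
    (fun A => by
      have h := (T.measurableSet_accept (bandParity r s A)).compl
      convert h using 1
      ext ω
      simp [NonAdaptiveAlgorithm.output])
    (fun A hA => hT.2 _ (hfar A (Finset.mem_filter.1 hA).2))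
    (K := (q : ℝ) ^ 2 * (2 ^ n * ((3 / 4) ^ (12 * r) * 2 ^ r)))
    (hae.mono fun ω hω S' _ hS' => by
      refine (card_filter_hasAltChain_le hs hk hks (T.queries ω) S' fun A hA =>
        exists_hasAltChain_of_reject hω (hS' A hA)).trans ?_
      gcongr
      exact hq ω)
  have hcard : (2 : ℝ) ^ n ≤ 2 * (S.card : ℝ) := by
    exact_mod_cast two_pow_le_two_mul_card_filter n
  -- The factor `12` is large enough for `(3/4)^12 * 2 ≤ 1/9 ≤ exp (-2)`; then `√n ≤ r + 1 ≤ 2 * r`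
  -- finishes.
  have hbase : (3 / 4 : ℝ) ^ (12 * r) * 2 ^ r ≤ Real.exp (-Real.sqrt n) := by
    have h1 : Real.exp 1 ≤ 3 := Real.exp_one_lt_d9.le.trans (by norm_num)
    have h2 : (3 / 4 : ℝ) ^ 12 * 2 ≤ Real.exp (-2) := by
      rw [Real.exp_neg, show (2 : ℝ) = 1 + 1 by norm_num, Real.exp_add]
      have h3 : Real.exp 1 * Real.exp 1 ≤ 9 := by nlinarith [Real.exp_pos 1]
      calc _ ≤ (9 : ℝ)⁻¹ := by norm_num
        _ ≤ _ := by gcongr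
    have h3 : Real.sqrt n ≤ r + 1 := by
      rw [Real.sqrt_le_left (by positivity), sq]
      exact_mod_cast hnr.le
    have h4 : (1 : ℝ) ≤ r := by exact_mod_cast hr
    calc _ = ((3 / 4 : ℝ) ^ 12 * 2) ^ r := by rw [pow_mul, mul_pow]
      _ ≤ Real.exp (-2) ^ r := by gcongr
      _ = Real.exp (r * -2) := (Real.exp_nat_mul _ _).symm
      _ ≤ _ := Real.exp_le_exp.2 (by linarith)
  have h2n : (0 : ℝ) < 2 ^ n := by positivity
  have h5 : (2 : ℝ) ^ n * (1 / 3) ≤ 2 ^ n * ((q : ℝ) ^ 2 * Real.exp (-Real.sqrt n)) := by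
    calc (2 : ℝ) ^ n * (1 / 3) ≤ 2 / 3 * (S.card : ℝ) := by linarith
      _ ≤ _ := hmain
      _ ≤ (q : ℝ) ^ 2 * (2 ^ n * Real.exp (-Real.sqrt n)) := by gcongr
      _ = _ := by ring
  have h6 := le_of_mul_le_mul_left h5 h2n
  rw [Real.exp_neg, ← div_eq_mul_inv, le_div_iff₀ (Real.exp_pos _)] at h6
  refine le_of_sq_le_sq ?_ (Nat.cast_nonneg q)
  rw [mul_pow, ← Real.exp_nat_mul]
  have h7 : ((2 : ℕ) : ℝ) * (Real.sqrt n / 2) = Real.sqrt n := by push_cast; ring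
  rw [h7]
  have := Real.exp_pos (Real.sqrt n)
  linarith

theorem mainTheorem1 :
    ∃ ε₀ : ℝ, 0 < ε₀ ∧ ε₀ ≤ 1 ∧
      (∃ c : ℝ, 0 < c ∧
        ∀ k : ℕ → ℕ, (∀ᶠ n in atTop, 2 ≤ k n) →
          ((fun n : ℕ => (k n : ℝ)) =o[atTop] fun n : ℕ => Real.sqrt (n : ℝ)) →
          ∀ᶠ n : ℕ in atTop, ∀ ε : ℝ, 0 < ε → ε ≤ ε₀ →
            NonAdaptiveOneSidedTestingRequires.{u} (kMonotone n (k n)) ε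
              (c * Real.exp (Real.sqrt (n : ℝ) / ((k n : ℝ) + 1)))) ∧
      (∃ c : ℝ, 0 < c ∧
        ∀ᶠ n : ℕ in atTop, ∀ ε : ℝ, 0 < ε → ε ≤ ε₀ →
          NonAdaptiveOneSidedTestingRequires.{u} (kMonotone n 2) ε
            ((2 : ℝ) ^ (c * Real.sqrt (n : ℝ)))) := by
  obtain ⟨ε₀, hε₀, hε₁, hfar⟩ := exists_le_distToProperty_bandParity
  have key : ∀ n k : ℕ, 888 * 888 ≤ n → 2 ≤ k → k ≤ Nat.sqrt n → ∀ ε ≤ ε₀,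
      NonAdaptiveOneSidedTestingRequires.{u} (kMonotone n k) ε
        (1 / 2 * Real.exp (Real.sqrt n / 2)) := by
    intro n k hn hk hkn ε hε Ω _ μ _ T q hT hq
    have hr : 888 ≤ Nat.sqrt n := Nat.le_sqrt.2 hn
    exact half_mul_exp_half_sqrt_le (by omega) (Nat.lt_succ_sqrt n) (Nat.succ_pos _) hk
      (Nat.lt_mul_div_succ (36 * Nat.sqrt n) (by omega : 0 < k)).le
      (fun A hA => hε.trans (hfar n k hr hk hkn A hA)) hT hq
  refine ⟨ε₀, hε₀, hε₁, ⟨1 / 2, by norm_num, fun k hk hko => ?_⟩, 1 / 3, by norm_num, ?_⟩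
  · filter_upwards [hk, hko.bound one_pos, eventually_ge_atTop (888 * 888)]
      with n hk2 hkn hn ε _ hε Ω _ μ _ T q hT hq
    -- The growth condition enters through the eventual bound `k n ≤ √n`.
    have hkn' : k n ≤ Nat.sqrt n := by
      rw [Nat.le_sqrt]
      rw [one_mul, Real.norm_natCast, Real.norm_of_nonneg (Real.sqrt_nonneg _),
        Real.le_sqrt (Nat.cast_nonneg _), sq] at hkn
      · exact_mod_cast hkn
      · exact Nat.cast_nonneg n
    refine le_trans ?_ (key n (k n) hn hk2 hkn' ε hε Ω μ T q hT hq)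
    have : (2 : ℝ) ≤ k n := by exact_mod_cast hk2
    gcongr
    linarith
  · filter_upwards [eventually_ge_atTop (888 * 888)] with n hn ε _ hε Ω _ μ _ T q hT hq
    have hr : 888 ≤ Nat.sqrt n := Nat.le_sqrt.2 hn
    refine le_trans ?_ (key n 2 hn le_rfl (by omega) ε hε Ω μ T q hT hq)
    -- Of the exponent `√n / 2`, the part `√n / 6` absorbs the factor `1 / 2` and `√n / 3` remains.
    have h6 : (6 : ℝ) ≤ Real.sqrt n := by
      apply Real.le_sqrt_of_sq_le
      have : ((888 * 888 : ℕ) : ℝ) ≤ n := by exact_mod_cast hn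
      norm_num at this ⊢
      linarith
    have h2 : (2 : ℝ) ≤ Real.exp (Real.sqrt n / 6) := by
      have := Real.add_one_le_exp (Real.sqrt n / 6)
      linarith
    have hlog : Real.log 2 ≤ 1 := Real.log_two_lt_d9.le.trans (by norm_num)
    calc (2 : ℝ) ^ (1 / 3 * Real.sqrt n) = Real.exp (Real.log 2 * (1 / 3 * Real.sqrt n)) :=
          Real.rpow_def_of_pos two_pos _
      _ ≤ Real.exp (Real.sqrt n / 3) := Real.exp_le_exp.2 (by nlinarith)
      _ = 1 / 2 * (2 * Real.exp (Real.sqrt n / 3)) := by ring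
      _ ≤ 1 / 2 * (Real.exp (Real.sqrt n / 6) * Real.exp (Real.sqrt n / 3)) := by gcongr
      _ = _ := by rw [← Real.exp_add]; ring_nf
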